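/- **Theorem (KT potentials and sublinear disagreement).** Let $\mathcal H$ be a real Hilbert space, let $\mathcal G$ be a connected graph on $N$ vertices (the agents), and let $W\in\mathbb R^{N\times N}$ be a gossip matrix for $\mathcal G$: $W$ is doubly stochastic with non-negative entries, $W_{mn}>0$ only if $m=n$ or $(m,n)$ is an edge of $\mathcal G$, and the spectral radius $\rho$ of $W-\frac1N\mathbf 1\mathbf 1^\top$ is less than $1$. Let $\epsilon>0$ and, for $t\ge 0$ and $|x|<t+1$, let $$F_t(x)=\epsilon\,\frac{2^t\,\Gamma\!\left(\frac{t+1}{2}+\frac x2\right)\Gamma\!\left(\frac{t+1}{2}-\frac x2\right)}{\pi\, t!},\qquad \beta_t(x)=\frac{F_t(x+1)-F_t(x-1)}{F_t(x+1)+F_t(x-1)},\qquad h_t(x)=\beta_t(x)F_{t-1}(x)\quad(t\ge 1,\ |x|<t)$$ be the Krichevsky–Trofimov potentials, betting fractions and betting functions. Let $c>0$ be a real number with $c\ge \frac{-2\ln 2}{\ln\rho}$ (if $\rho=0$, only $c>0$ is required), and put $q(t)=\lceil ct\rceil$. Consider DECO-ii: every agent $n$ starts from $G_{n,0}=0$,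 and in each round $t=1,2,\dots$ it plays $x_{n,t}=h_t(\|G_{n,t-1}\|)\,G_{n,t-1}/\|G_{n,t-1}\|$ (and $x_{n,t}=0$ if $G_{n,t-1}=0$; for $\mathcal H=\mathbb R$ this is $x_{n,t}=h_t(G_{n,t-1})$), receives a subgradient $g_{n,t}$ at $x_{n,t}$ of its convex, $1$-Lipschitz local loss $l_{n,t}:\mathcal H\to\mathbb R$, and after $q(t)$ gossip steps holds $G_{n,t}=\sum_{m=1}^N (W^{q(t)})_{nm}\,(G_{m,t-1}-g_{m,t})$. With $l_t=\frac1N\sum_{m=1}^N l_{m,t}$, define the network regret and the disagreement by $$R_T^{\mathrm{net}}(u)=\sum_{t=1}^T\frac1N\sum_{n=1}^N l_t(x_{n,t})-\sum_{t=1}^T l_t(u),\qquad D_T=\sum_{t=1}^T\frac1N\sum_{n=1}^N\bigl(l_t(x_{n,t})-l_{n,t}(x_{n,t})\bigr).$$ Then $\beta_t(x)=x/t$ for all $t\ge1$ and $|x|<t$, and both the regret and the disagreement are sublinear, uniformly over all loss sequences and all choices of subgradients: for every $u\in\mathcal H$ there is a function $B_u:\mathbb N\to\mathbb R$ with $B_u(T)=o(T)$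 such that every run of DECO-ii satisfies $R_T^{\mathrm{net}}(u)\le B_u(T)$ for all $T$, and there is a function $B:\mathbb N\to\mathbb R$ with $B(T)=o(T)$ such that every run satisfies $|D_T|\le B(T)$ for all $T$. -/

import Mathlib

/-- `g` is a subgradient of `f` at `x`. -/
def IsSubgradient {H : Type*} [NormedAddCommGroup H] [InnerProductSpace ℝ H]
    (f : H → ℝ) (x g : H) : Prop :=
  ∀ y : H, f x + inner ℝ g (y - x) ≤ f y

/-- The Krichevsky-Trofimov potential with initial endowment `ε`; its domain is `|x| < t + 1`. -/
noncomputable def ktPotential (ε : ℝ) (t : ℕ) (x : ℝ) : ℝ :=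
  ε * (2 ^ t * Real.Gamma (((t : ℝ) + 1) / 2 + x / 2) * Real.Gamma (((t : ℝ) + 1) / 2 - x / 2)
    / (Real.pi * (t.factorial : ℝ)))

/-- The betting fraction `β_t(x)` derived from the potentials `F`. -/
noncomputable def bettingFraction (F : ℕ → ℝ → ℝ) (t : ℕ) (x : ℝ) : ℝ :=
  (F t (x + 1) - F t (x - 1)) / (F t (x + 1) + F t (x - 1))

/-- The betting function `h_t(x) = β_t(x) F_{t-1}(x)`, meant for `t ≥ 1`. -/
noncomputable def bettingFunction (F : ℕ → ℝ → ℝ) (t : ℕ) (x : ℝ) : ℝ :=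
  bettingFraction F t x * F (t - 1) x

/-- The betting function on a Hilbert space, `v ↦ h_t(‖v‖) v / ‖v‖`, with value `0` at `v = 0`.
For even potentials `h_t` is odd, so on `ℝ` this is `h_t` itself. -/
noncomputable def bettingMap {H : Type*} [NormedAddCommGroup H] [InnerProductSpace ℝ H]
    (F : ℕ → ℝ → ℝ) (t : ℕ) (v : H) : H :=
  (bettingFunction F t ‖v‖ / ‖v‖) • v

/-- The spectral radius of `W - (1/N) 1 1ᵀ`: the largest modulus of a complex eigenvalue. -/
noncomputable def gossipRadius {N : ℕ} (W : Matrix (Fin N) (Fin N) ℝ) : ℝ :=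
  (spectralRadius ℂ ((W - Matrix.of fun _ _ => 1 / (N : ℝ)).map Complex.ofReal)).toReal

/-- `W` is a gossip matrix for the connected graph `𝒢`. -/
structure IsGossipMatrix {N : ℕ} (𝒢 : SimpleGraph (Fin N)) (W : Matrix (Fin N) (Fin N) ℝ) :
    Prop where
  connected : 𝒢.Connected
  doublyStochastic : W ∈ doublyStochastic ℝ (Fin N)
  support : ∀ m n, 0 < W m n → 𝒢.Adj m n ∨ m = n
  radius_lt_one : gossipRadius W < 1

/-- The local losses `l n t` (agent `n`, round `t ≥ 1`) are convex and 1-Lipschitz. -/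
def AdmissibleLosses {N : ℕ} {H : Type*} [NormedAddCommGroup H] [InnerProductSpace ℝ H]
    (l : Fin N → ℕ → H → ℝ) : Prop :=
  ∀ n t, 1 ≤ t → ConvexOn ℝ Set.univ (l n t) ∧ LipschitzWith 1 (l n t)

/-- `x`, `g`, `G` are the decisions, subgradients and states of a run of DECO-ii with potentials
`F`, gossip matrix `W` and `q t` gossip steps in round `t`, on the losses `l`. -/
structure IsDecoRun {N : ℕ} {H : Type*} [NormedAddCommGroup H] [InnerProductSpace ℝ H]
    (F : ℕ → ℝ → ℝ) (W : Matrix (Fin N) (Fin N) ℝ) (q : ℕ → ℕ)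
    (l : Fin N → ℕ → H → ℝ) (x g G : Fin N → ℕ → H) : Prop where
  init : ∀ n, G n 0 = 0
  play : ∀ n t, 1 ≤ t → x n t = bettingMap F t (G n (t - 1))
  feedback : ∀ n t, 1 ≤ t → IsSubgradient (l n t) (x n t) (g n t)
  gossip : ∀ n t, 1 ≤ t → G n t = ∑ m, (W ^ q t) n m • (G m (t - 1) - g m t)

/-- The global loss `l_t`, the average of the local losses. -/
noncomputable def globalLoss {N : ℕ} {H : Type*} (l : Fin N → ℕ → H → ℝ) (t : ℕ) (y : H) : ℝ :=
  (1 / (N : ℝ)) * ∑ m, l m t y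

/-- The network regret after `T` rounds against the comparator `u`. -/
noncomputable def networkRegret {N : ℕ} {H : Type*} (l : Fin N → ℕ → H → ℝ)
    (x : Fin N → ℕ → H) (u : H) (T : ℕ) : ℝ :=
  (∑ t ∈ Finset.Icc 1 T, (1 / (N : ℝ)) * ∑ n, globalLoss l t (x n t))
    - ∑ t ∈ Finset.Icc 1 T, globalLoss l t u

/-- The disagreement after `T` rounds: the excess of the global over the local losses incurred. -/
noncomputable def disagreement {N : ℕ} {H : Type*} (l : Fin N → ℕ → H → ℝ)
    (x : Fin N → ℕ → H) (T : ℕ) : ℝ :=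
  ∑ t ∈ Finset.Icc 1 T, (1 / (N : ℝ)) * ∑ n, (globalLoss l t (x n t) - l n t (x n t))

/-- A bound that is sublinear in the number of rounds. -/
def IsSublinear (B : ℕ → ℝ) : Prop :=
  Asymptotics.IsLittleO Filter.atTop B (fun T : ℕ => (T : ℝ))

/-! Gossip preserves averages, so the mean of the agents' states evolves exactly like the state of
one virtual KT bettor fed the averaged subgradients (`IsDecoRun.agentMean_state_succ`). The agents
are compared with this bettor.

For its regret, the Gamma recursion gives `F_{t+1}(x ± 1) = (1 ± x/(t+1)) F_t(x)`, and Euler's limit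
formula makes `y ↦ F_t(√y)` convex and increasing. Together they yield the one-round inequality
`ktPotential_norm_sub_le`, which telescopes. What remains is a constant plus `‖G‖ ‖u‖ - F_T(‖G‖)`,
where `G` is the mean state and `‖G‖ ≤ T`. This is at most o(T), because `F_T(y)` is exponentially
large in `T` as soon as `y ≥ δ T` (`ktPotential_superlinear`).

For the cost of decentralisation, the Lipschitz constant of the bet grows at most like `t 2^t`
(`norm_bettingMap_sub_le`), while gossip brings each state within O(`t 3^{-t}`) of the mean
(`exists_abs_gossip_pow_ceil_sub_le`). The plays therefore deviate from the virtual one by O(`t²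
(2/3)^t`), which is summable. As the losses are 1-Lipschitz, this adds only a constant to the regret
and bounds the disagreement by a constant. -/

/-! ### Recursion for the KT potentials and their betting fractions. -/

theorem ktPotential_eq (ε : ℝ) (t : ℕ) (x : ℝ) : ktPotential ε t x =
    ε * 2 ^ t / (Real.pi * (t.factorial : ℝ)) *
      (Real.Gamma (((t : ℝ) + 1) / 2 + x / 2) * Real.Gamma (((t : ℝ) + 1) / 2 - x / 2)) := by
  unfold ktPotential
  ring

theorem ktPotential_pos {ε : ℝ} (hε : 0 < ε) {t : ℕ} {x : ℝ} (hx : |x| < t + 1) :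
    0 < ktPotential ε t x := by
  rw [abs_lt] at hx
  rw [ktPotential_eq]
  have h1 := Real.Gamma_pos_of_pos (show 0 < ((t : ℝ) + 1) / 2 + x / 2 by linarith)
  have h2 := Real.Gamma_pos_of_pos (show 0 < ((t : ℝ) + 1) / 2 - x / 2 by linarith)
  have := Real.pi_pos
  positivity

theorem ktPotential_neg (ε : ℝ) (t : ℕ) (x : ℝ) :
    ktPotential ε t (-x) = ktPotential ε t x := by
  rw [ktPotential_eq, ktPotential_eq, mul_comm (Real.Gamma _)]
  congr 3 <;> ring_nf

theorem ktPotential_abs (ε : ℝ) (t : ℕ) (x : ℝ) :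
    ktPotential ε t |x| = ktPotential ε t x := by
  rcases abs_choice x with h | h <;> rw [h]
  exact ktPotential_neg ε t x

theorem ktPotential_zero_zero (ε : ℝ) : ktPotential ε 0 0 = ε := by
  rw [ktPotential_eq]
  simp only [Nat.cast_zero, zero_add, zero_div, add_zero, sub_zero, Real.Gamma_one_half_eq,
    Real.mul_self_sqrt Real.pi_pos.le]
  have := Real.pi_pos.ne'
  simp

theorem ktPotential_succ_add_one (ε : ℝ) {t : ℕ} {x : ℝ} (hx : |x| < t + 1) :
    ktPotential ε (t + 1) (x + 1) = (1 + x / (t + 1)) * ktPotential ε t x := by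
  rw [abs_lt] at hx
  have h1 : ((t + 1 : ℕ) + 1 : ℝ) / 2 + (x + 1) / 2 = (((t : ℝ) + 1) / 2 + x / 2) + 1 := by
    push_cast; ring
  have h2 : ((t + 1 : ℕ) + 1 : ℝ) / 2 - (x + 1) / 2 = ((t : ℝ) + 1) / 2 - x / 2 := by
    push_cast; ring
  rw [ktPotential_eq, ktPotential_eq, h1, h2, Real.Gamma_add_one (by linarith),
    Nat.factorial_succ]
  push_cast
  have := Real.pi_pos.ne'
  have : (t : ℝ) + 1 ≠ 0 := by positivity
  field_simp
  ring

theorem ktPotential_succ_sub_one (ε : ℝ) {t : ℕ} {x : ℝ} (hx : |x| < t + 1) :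
    ktPotential ε (t + 1) (x - 1) = (1 - x / (t + 1)) * ktPotential ε t x := by
  have := ktPotential_succ_add_one ε (t := t) (x := -x) (by rwa [abs_neg])
  rw [← ktPotential_neg, ← ktPotential_neg ε t, show -(x - 1) = -x + 1 by ring, this]
  ring

theorem bettingFraction_ktPotential {ε : ℝ} (hε : 0 < ε) {t : ℕ} {x : ℝ} (hx : |x| < t + 1) :
    bettingFraction (ktPotential ε) (t + 1) x = x / (t + 1) := by
  unfold bettingFraction
  rw [ktPotential_succ_add_one ε hx, ktPotential_succ_sub_one ε hx]
  have := (ktPotential_pos hε hx).ne'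
  have : (t : ℝ) + 1 ≠ 0 := by positivity
  field_simp
  ring

theorem bettingMap_ktPotential {H : Type*} [NormedAddCommGroup H] [InnerProductSpace ℝ H]
    {ε : ℝ} (hε : 0 < ε) {t : ℕ} {v : H} (hv : ‖v‖ < t + 1) :
    bettingMap (ktPotential ε) (t + 1) v = (ktPotential ε t ‖v‖ / (t + 1)) • v := by
  unfold bettingMap bettingFunction
  rw [bettingFraction_ktPotential hε (by rwa [abs_norm])]
  rcases eq_or_ne v 0 with rfl | h
  · simp
  · have : ‖v‖ ≠ 0 := by simpa using h
    congr 1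
    simp only [Nat.add_sub_cancel]
    field_simp

/-! ### Convexity of the potentials in the squared argument. -/

theorem convexOn_inv_const_sub {b c : ℝ} (h : c ≤ b) :
    ConvexOn ℝ (Set.Iio c) (fun y => (b - y)⁻¹) := by
  refine ⟨convex_Iio c, fun x hx y hy p q hp hq hpq => ?_⟩
  rw [Set.mem_Iio] at hx hy
  have h1 := (convexOn_zpow (𝕜 := ℝ) (-1)).2 (x := b - x) (y := b - y)
    (by simp; linarith) (by simp; linarith) hp hq hpq
  simp only [smul_eq_mul, zpow_neg, zpow_one] at h1 ⊢
  have h2 : p * (b - x) + q * (b - y) = b - (p * x + q * y) := by linear_combination b * hpq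
  rwa [h2] at h1

theorem monotoneOn_inv_const_sub {b c : ℝ} (h : c ≤ b) :
    MonotoneOn (fun y => (b - y)⁻¹) (Set.Iio c) := by
  intro x hx y hy hxy
  rw [Set.mem_Iio] at hx hy
  exact inv_anti₀ (by linarith) (by linarith)

/-- A product of nonnegative convex functions is convex when they are monotone in the same
direction, so the induction carries convexity together with monotonicity. -/
theorem prod_inv_const_sub_convexOn_monotoneOn {c : ℝ} {b : ℕ → ℝ} (h : ∀ j, c ≤ b j) (n : ℕ) :
    ConvexOn ℝ (Set.Iio c) (fun y => ∏ j ∈ Finset.range n, (b j - y)⁻¹) ∧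
    MonotoneOn (fun y => ∏ j ∈ Finset.range n, (b j - y)⁻¹) (Set.Iio c) ∧
    ∀ y ∈ Set.Iio c, 0 ≤ ∏ j ∈ Finset.range n, (b j - y)⁻¹ := by
  have pos : ∀ (n : ℕ), ∀ y ∈ Set.Iio c, 0 ≤ ∏ j ∈ Finset.range n, (b j - y)⁻¹ := by
    intro n y hy
    refine Finset.prod_nonneg fun j _ => inv_nonneg.2 ?_
    have := h j
    rw [Set.mem_Iio] at hy
    linarith
  have pos1 : ∀ j, ∀ y ∈ Set.Iio c, 0 ≤ (b j - y)⁻¹ := by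
    intro j y hy
    have := h j
    rw [Set.mem_Iio] at hy
    exact inv_nonneg.2 (by linarith)
  induction n with
  | zero => simpa using ⟨convexOn_const _ (convex_Iio c), monotoneOn_const⟩
  | succ n ih =>
    obtain ⟨h1, h2, -⟩ := ih
    have h3 := monotoneOn_inv_const_sub (h n)
    refine ⟨?_, ?_, pos _⟩
    · simp only [Finset.prod_range_succ]
      exact h1.mul (convexOn_inv_const_sub (h n)) (pos n) (pos1 n) (h2.monovaryOn h3)
    · simp only [Finset.prod_range_succ]
      exact h2.mul h3 (pos n) (pos1 n)

/-- The factors pair up as `(a + j + √y)(a + j - √y) = (a + j)² - y`, which removes the square root.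
-/
theorem gammaSeq_mul_gammaSeq {a y : ℝ} (hy : 0 ≤ y) {n : ℕ} (hn : 0 < n) :
    Real.GammaSeq (a + √y) n * Real.GammaSeq (a - √y) n =
      (n : ℝ) ^ (2 * a) * (n.factorial : ℝ) ^ 2 *
        ∏ j ∈ Finset.range (n + 1), ((a + j) ^ 2 - y)⁻¹ := by
  have hn' : (0 : ℝ) < n := by exact_mod_cast hn
  have h1 : (n : ℝ) ^ (2 * a) = (n : ℝ) ^ (a + √y) * (n : ℝ) ^ (a - √y) := by
    rw [← Real.rpow_add hn']
    ring_nf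
  unfold Real.GammaSeq
  rw [h1, div_mul_div_comm, ← Finset.prod_mul_distrib, Finset.prod_inv_distrib, div_eq_mul_inv]
  have h2 : ∀ j : ℕ, (a + √y + j) * (a - √y + j) = (a + j) ^ 2 - y := by
    intro j
    linear_combination - Real.sq_sqrt hy
  simp only [h2]
  ring

/-- Both properties hold for the finite products in Euler's formula and pass to pointwise limits. -/
theorem Gamma_mul_Gamma_convexOn_monotoneOn {a : ℝ} (ha : 0 < a) :
    ConvexOn ℝ (Set.Ico 0 (a ^ 2)) (fun y => Real.Gamma (a + √y) * Real.Gamma (a - √y)) ∧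
    MonotoneOn (fun y => Real.Gamma (a + √y) * Real.Gamma (a - √y)) (Set.Ico 0 (a ^ 2)) := by
  have key : ∀ n, _ := fun n => prod_inv_const_sub_convexOn_monotoneOn
    (c := a ^ 2) (b := fun j => (a + j) ^ 2) (fun j => by gcongr; simp) (n + 1)
  have tends : ∀ y, Filter.Tendsto
      (fun n => Real.GammaSeq (a + √y) n * Real.GammaSeq (a - √y) n) Filter.atTop
      (nhds (Real.Gamma (a + √y) * Real.Gamma (a - √y))) := fun y =>
    (Real.GammaSeq_tendsto_Gamma _).mul (Real.GammaSeq_tendsto_Gamma _)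
  constructor
  · refine ⟨convex_Ico _ _, fun x hx y hy p q hp hq hpq => ?_⟩
    have hz := convex_Ico 0 (a ^ 2) hx hy hp hq hpq
    refine le_of_tendsto_of_tendsto (tends _) (((tends x).const_mul p).add ((tends y).const_mul q))
      ?_
    filter_upwards [Filter.eventually_gt_atTop 0] with n hn
    rw [gammaSeq_mul_gammaSeq hz.1 hn, gammaSeq_mul_gammaSeq hx.1 hn,
      gammaSeq_mul_gammaSeq hy.1 hn]
    have := (key n).1.2 (Set.mem_Iio.2 hx.2) (Set.mem_Iio.2 hy.2) hp hq hpq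
    have := mul_le_mul_of_nonneg_left this
      (show 0 ≤ (n : ℝ) ^ (2 * a) * (n.factorial : ℝ) ^ 2 by positivity)
    simp only [smul_eq_mul] at this ⊢
    linarith
  · intro x hx y hy hxy
    refine le_of_tendsto_of_tendsto (tends x) (tends y) ?_
    filter_upwards [Filter.eventually_gt_atTop 0] with n hn
    rw [gammaSeq_mul_gammaSeq hx.1 hn, gammaSeq_mul_gammaSeq hy.1 hn]
    exact mul_le_mul_of_nonneg_left ((key n).2.1 hx.2 hy.2 hxy) (by positivity)

theorem ktPotential_sqrt_convexOn_monotoneOn {ε : ℝ} (hε : 0 < ε) (t : ℕ) :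
    ConvexOn ℝ (Set.Ico 0 (((t : ℝ) + 1) ^ 2)) (fun y => ktPotential ε t (√y)) ∧
    MonotoneOn (fun y => ktPotential ε t (√y)) (Set.Ico 0 (((t : ℝ) + 1) ^ 2)) := by
  obtain ⟨h1, h2⟩ := Gamma_mul_Gamma_convexOn_monotoneOn (a := ((t : ℝ) + 1) / 2) (by positivity)
  have hs : ∀ y : ℝ, √y / 2 = √(y / 4) := by
    intro y
    rw [Real.sqrt_div' _ (by norm_num), show (4 : ℝ) = 2 ^ 2 by norm_num,
      Real.sqrt_sq (by norm_num)]
  have hk : 0 ≤ ε * 2 ^ t / (Real.pi * (t.factorial : ℝ)) := by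
    have := Real.pi_pos
    positivity
  have mem : ∀ y ∈ Set.Ico 0 (((t : ℝ) + 1) ^ 2), y / 4 ∈ Set.Ico 0 ((((t : ℝ) + 1) / 2) ^ 2) := by
    rintro y ⟨hy1, hy2⟩
    exact ⟨by positivity, by linarith⟩
  constructor
  · refine ⟨convex_Ico _ _, fun x hx y hy p q hp hq hpq => ?_⟩
    have := h1.2 (mem x hx) (mem y hy) hp hq hpq
    simp only [ktPotential_eq, hs, smul_eq_mul] at this ⊢
    have := mul_le_mul_of_nonneg_left this hk
    rw [show p * (x / 4) + q * (y / 4) = (p * x + q * y) / 4 by ring] at this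
    linarith
  · intro x hx y hy hxy
    simp only [ktPotential_eq, hs]
    exact mul_le_mul_of_nonneg_left (h2 (mem x hx) (mem y hy) (by linarith)) hk

theorem ktPotential_mono {ε : ℝ} (hε : 0 < ε) {t : ℕ} {x y : ℝ} (hx : 0 ≤ x) (hxy : x ≤ y)
    (hy : y < t + 1) : ktPotential ε t x ≤ ktPotential ε t y := by
  have hx2 : x ^ 2 ∈ Set.Ico 0 (((t : ℝ) + 1) ^ 2) := ⟨by positivity, by gcongr; linarith⟩
  have hy2 : y ^ 2 ∈ Set.Ico 0 (((t : ℝ) + 1) ^ 2) := ⟨by positivity, by gcongr; linarith⟩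
  have := (ktPotential_sqrt_convexOn_monotoneOn hε t).2 hx2 hy2 (by gcongr)
  simpa [Real.sqrt_sq hx, Real.sqrt_sq (hx.trans hxy)] using this

/-! ### One round of betting in an inner product space. -/

/-- With `r = ‖v‖`, `‖v - g‖²` is at most a convex combination of `(r + 1)²` and `(r - 1)²`.
Convexity in the squared norm thus reduces the claim to the two scalar recursions. -/
theorem ktPotential_norm_sub_le {H : Type*} [NormedAddCommGroup H] [InnerProductSpace ℝ H]
    {ε : ℝ} (hε : 0 < ε) {t : ℕ} {v g : H} (hv : ‖v‖ ≤ t) (hg : ‖g‖ ≤ 1) :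
    ktPotential ε (t + 1) ‖v - g‖ ≤
      ktPotential ε t ‖v‖ - inner ℝ g ((ktPotential ε t ‖v‖ / (t + 1)) • v) := by
  rcases eq_or_ne v 0 with rfl | hv0
  · have h1 : ktPotential ε (t + 1) (0 + 1) = _ := ktPotential_succ_add_one ε (x := 0)
      (by simpa using by positivity)
    have h2 := ktPotential_mono hε (t := t + 1) (norm_nonneg g) hg (by push_cast; simpa using by positivity)
    simp at h1 ⊢
    linarith
  set r := ‖v‖ with hr
  have hr0 : 0 < r := norm_pos_iff.2 hv0
  -- The component of `-g` along `v`; the combination has weights `(1 ± s)/2`.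
  set s := -(inner ℝ v g) / r with hs
  have hrs : r * s = -(inner ℝ v g) := by rw [hs]; field_simp
  have hi : |inner ℝ v g| ≤ r * 1 := (abs_real_inner_le_norm v g).trans (by gcongr)
  rw [abs_le] at hi
  have hs1 : s ≤ 1 := le_of_mul_le_mul_left (by linarith) hr0
  have hs2 : -1 ≤ s := le_of_mul_le_mul_left (by linarith) hr0
  have hnorm : ‖v - g‖ ^ 2 ≤ r ^ 2 + 2 * (r * s) + 1 := by
    rw [norm_sub_sq_real, hrs]
    have : ‖g‖ ^ 2 ≤ 1 := by simpa using pow_le_one₀ (norm_nonneg g) hg (n := 2)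
    linarith
  have hrt : r + 1 < ((t + 1 : ℕ) : ℝ) + 1 := by push_cast; linarith
  have hp : (r + 1) ^ 2 ∈ Set.Ico (0 : ℝ) ((((t + 1 : ℕ) : ℝ) + 1) ^ 2) :=
    ⟨by positivity, by gcongr⟩
  have hm : (r - 1) ^ 2 ∈ Set.Ico (0 : ℝ) ((((t + 1 : ℕ) : ℝ) + 1) ^ 2) :=
    ⟨by positivity, lt_of_le_of_lt (by nlinarith) hp.2⟩
  have hcomb : r ^ 2 + 2 * (r * s) + 1 =
      ((1 + s) / 2) * (r + 1) ^ 2 + ((1 - s) / 2) * (r - 1) ^ 2 := by ring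
  have hle : r ^ 2 + 2 * (r * s) + 1 ≤ (r + 1) ^ 2 := by nlinarith
  obtain ⟨hconv, hmono⟩ := ktPotential_sqrt_convexOn_monotoneOn hε (t + 1)
  have h0 : 0 ≤ ‖v - g‖ ^ 2 := by positivity
  have h1 := hmono ⟨h0, lt_of_le_of_lt (hnorm.trans hle) hp.2⟩
    ⟨h0.trans hnorm, lt_of_le_of_lt hle hp.2⟩ hnorm
  have h2 := hconv.2 hp hm (show 0 ≤ (1 + s) / 2 by linarith) (show 0 ≤ (1 - s) / 2 by linarith)
    (by ring)
  have hrt' : |r| < (t : ℝ) + 1 := by rw [abs_of_pos hr0]; linarith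
  -- Evenness of the potential covers `r < 1`, where `√((r - 1)²) = 1 - r`.
  simp only [smul_eq_mul, Real.sqrt_sq_eq_abs, ktPotential_abs, ← hcomb] at h1 h2
  rw [ktPotential_succ_add_one ε hrt', ktPotential_succ_sub_one ε hrt'] at h2
  refine (h1.trans h2).trans (le_of_eq ?_)
  rw [inner_smul_right, real_inner_comm, show inner ℝ v g = -(r * s) by linarith]
  field_simp
  ring

/-! ### Exponential bound on the Lipschitz constant of the bet. -/

/-- Each step of the recursion at most doubles the value. The offset `1/2` leaves room to the right
of `[0, t]` for a slope comparison. -/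
theorem ktPotential_half_le {ε : ℝ} (hε : 0 < ε) (t : ℕ) :
    ktPotential ε t (t + 1 / 2) ≤ 2 ^ t * ktPotential ε 0 (1 / 2) := by
  induction t with
  | zero => simp
  | succ t ih =>
    have hx : |(t : ℝ) + 1 / 2| < t + 1 := by
      rw [abs_of_pos (by positivity)]
      linarith
    have h0 := ktPotential_pos hε hx
    push_cast
    rw [show (t : ℝ) + 1 + 1 / 2 = (t + 1 / 2) + 1 by ring, ktPotential_succ_add_one ε hx]
    have : ((t : ℝ) + 1 / 2) / (t + 1) ≤ 1 := by
      rw [div_le_one (by positivity)]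
      linarith
    calc _ ≤ 2 * ktPotential ε t (t + 1 / 2) := by gcongr; linarith
      _ ≤ 2 * (2 ^ t * ktPotential ε 0 (1 / 2)) := by gcongr
      _ = _ := by ring

theorem ktPotential_sub_le {ε : ℝ} (hε : 0 < ε) {t : ℕ} {x y : ℝ} (hx : 0 ≤ x) (hxy : x ≤ y)
    (hy : y ≤ t) : ktPotential ε t y - ktPotential ε t x ≤
      8 * t * (2 ^ t * ktPotential ε 0 (1 / 2)) * (y - x) := by
  rcases eq_or_lt_of_le hxy with rfl | hlt
  · simp
  have ht : (1 : ℝ) ≤ t := by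
    have : 0 < t := by
      have : (0 : ℝ) < t := by linarith
      exact_mod_cast this
    exact_mod_cast this
  have hK := ktPotential_half_le hε t
  set K := 2 ^ t * ktPotential ε 0 (1 / 2)
  have hpos := ktPotential_pos hε (t := t) (x := y) (by rw [abs_of_pos] <;> linarith)
  have hK0 : 0 < K := lt_of_lt_of_le (ktPotential_pos hε (t := t) (x := t + 1 / 2)
    (by rw [abs_of_pos] <;> linarith)) hK
  have h := (ktPotential_sqrt_convexOn_monotoneOn hε t).1.slope_mono_adjacent
    (x := x ^ 2) (y := y ^ 2) (z := ((t : ℝ) + 1 / 2) ^ 2)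
    ⟨by positivity, by gcongr; linarith⟩ ⟨by positivity, by gcongr; linarith⟩
    (by gcongr) (pow_lt_pow_left₀ (by linarith) (by linarith) two_ne_zero)
  simp only [Real.sqrt_sq hx, Real.sqrt_sq (hx.trans hxy),
    Real.sqrt_sq (show (0 : ℝ) ≤ t + 1 / 2 by positivity)] at h
  have h2 : (ktPotential ε t (t + 1 / 2) - ktPotential ε t y) / ((t + 1 / 2) ^ 2 - y ^ 2) ≤ K := by
    -- Since `y ≤ t`, the difference is at least `t + 1/4`.
    have h3 : 1 ≤ ((t : ℝ) + 1 / 2) ^ 2 - y ^ 2 := by nlinarith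
    rw [div_le_iff₀ (by linarith)]
    nlinarith
  have h3 := h.trans h2
  rw [div_le_iff₀ (by nlinarith)] at h3
  refine h3.trans ?_
  have : y ^ 2 - x ^ 2 ≤ 8 * t * (y - x) := by nlinarith
  calc K * (y ^ 2 - x ^ 2) ≤ K * (8 * t * (y - x)) := by gcongr
    _ = _ := by ring

theorem abs_ktPotential_sub_le {ε : ℝ} (hε : 0 < ε) {t : ℕ} {x y : ℝ} (hx0 : 0 ≤ x) (hx : x ≤ t)
    (hy0 : 0 ≤ y) (hy : y ≤ t) : |ktPotential ε t y - ktPotential ε t x| ≤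
      8 * t * (2 ^ t * ktPotential ε 0 (1 / 2)) * |y - x| := by
  wlog hxy : x ≤ y generalizing x y
  · rw [abs_sub_comm, abs_sub_comm y]
    exact this hy0 hy hx0 hx (le_of_not_ge hxy)
  rw [abs_of_nonneg (sub_nonneg.2 hxy), abs_of_nonneg]
  · exact ktPotential_sub_le hε hx0 hxy hy
  · exact sub_nonneg.2 (ktPotential_mono hε hx0 hxy (by linarith))

theorem norm_bettingMap_sub_le {H : Type*} [NormedAddCommGroup H] [InnerProductSpace ℝ H]
    {ε : ℝ} (hε : 0 < ε) {t : ℕ} {v w : H} (hv : ‖v‖ ≤ t) (hw : ‖w‖ ≤ t) :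
    ‖bettingMap (ktPotential ε) (t + 1) v - bettingMap (ktPotential ε) (t + 1) w‖ ≤
      8 * (t + 1) * (2 ^ t * ktPotential ε 0 (1 / 2)) * ‖v - w‖ := by
  rw [bettingMap_ktPotential hε (by linarith), bettingMap_ktPotential hε (by linarith)]
  have h1 := abs_ktPotential_sub_le hε (norm_nonneg w) hw (norm_nonneg v) hv
  have h2 : ktPotential ε t ‖v‖ ≤ 2 ^ t * ktPotential ε 0 (1 / 2) :=
    (ktPotential_mono hε (norm_nonneg v) (by linarith) (by linarith)).trans
      (ktPotential_half_le hε t)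
  have h3 := ktPotential_pos hε (t := t) (x := ‖v‖) (by rw [abs_norm]; linarith)
  set K := 2 ^ t * ktPotential ε 0 (1 / 2)
  have hK : 0 < K := h3.trans_le h2
  have e : (ktPotential ε t ‖v‖ / (t + 1)) • v - (ktPotential ε t ‖w‖ / (t + 1)) • w =
      ((t : ℝ) + 1)⁻¹ • (ktPotential ε t ‖v‖ • (v - w) +
        (ktPotential ε t ‖v‖ - ktPotential ε t ‖w‖) • w) := by
    simp only [div_eq_inv_mul, mul_smul, smul_sub, sub_smul, smul_add]
    abel
  have ht : (0 : ℝ) ≤ t := by positivity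
  rw [e, norm_smul, norm_inv, Real.norm_of_nonneg (by positivity : (0 : ℝ) ≤ t + 1),
    inv_mul_le_iff₀ (by positivity)]
  calc _ ≤ ktPotential ε t ‖v‖ * ‖v - w‖ + |ktPotential ε t ‖v‖ - ktPotential ε t ‖w‖| * ‖w‖ := by
        refine (norm_add_le _ _).trans (le_of_eq ?_)
        rw [norm_smul, norm_smul, Real.norm_of_nonneg h3.le, Real.norm_eq_abs]
    _ ≤ K * ‖v - w‖ + (8 * t * K * ‖v - w‖) * t := by
        gcongr
        exact h1.trans (by gcongr; exact abs_norm_sub_norm_le v w)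
    _ ≤ _ := by
        have : 0 ≤ K * ‖v - w‖ := by positivity
        nlinarith [mul_nonneg ht this]

/-! ### Superlinear growth of the potentials. -/

/-- Going up by one and back gives `F_{t+2}(0) = (t+1)/(t+2) · F_t(0)`. This links times of equal
parity, hence the minimum over times 0 and 1 and an induction on consecutive pairs. -/
theorem ktPotential_at_zero_ge {ε : ℝ} (hε : 0 < ε) :
    ∃ a > 0, ∀ t : ℕ, a / (t + 1) ≤ ktPotential ε t 0 := by
  have h0 := ktPotential_pos hε (t := 0) (x := 0) (by simp)
  have h1 := ktPotential_pos hε (t := 1) (x := 0) (by simp)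
  set A := min (ktPotential ε 0 0) (ktPotential ε 1 0) with hA
  have key : ∀ t : ℕ, A / (t + 1) ≤ ktPotential ε t 0 ∧
      A / (t + 1 + 1) ≤ ktPotential ε (t + 1) 0 := by
    intro t
    have hA0 : 0 < A := lt_min h0 h1
    induction t with
    | zero =>
      constructor
      · simp [hA]
      · norm_num
        have : A ≤ ktPotential ε 1 0 := min_le_right _ _
        linarith
    | succ t ih =>
      push_cast
      refine ⟨ih.2, ?_⟩
      have e1 := ktPotential_succ_add_one ε (t := t) (x := 0) (by simpa using by positivity)
      have e2 := ktPotential_succ_sub_one ε (t := t + 1) (x := 1) (by push_cast; simpa using by positivity)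
      simp only [zero_add, sub_self, zero_div, add_zero, one_mul] at e1 e2
      rw [e2, e1]
      push_cast
      have : (1 - 1 / ((t : ℝ) + 1 + 1)) * (A / (t + 1)) ≤
          (1 - 1 / ((t : ℝ) + 1 + 1)) * ktPotential ε t 0 := by
        refine mul_le_mul_of_nonneg_left ih.1 ?_
        rw [sub_nonneg, div_le_one (by positivity)]
        linarith [(Nat.cast_nonneg t : (0 : ℝ) ≤ t)]
      refine le_trans ?_ this
      have : (1 - 1 / ((t : ℝ) + 1 + 1)) * (A / (t + 1)) = A / (t + 1 + 1) := by
        field_simp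
        ring
      rw [this]
      gcongr
      linarith
  exact ⟨A, lt_min h0 h1, fun t => (key t).1⟩

/-- Both values come from `F_{t-1}(x + 1)`, by a step up and a step down. -/
theorem ktPotential_add_two_ge {ε : ℝ} (hε : 0 < ε) {t : ℕ} {x : ℝ} (hx : 0 ≤ x)
    (hxt : x + 2 ≤ t) : (1 + x / t) * ktPotential ε t x ≤ ktPotential ε t (x + 2) := by
  obtain ⟨t, rfl⟩ : ∃ s, t = s + 1 := Nat.exists_eq_succ_of_ne_zero (by
    rintro rfl
    norm_num at hxt
    linarith)
  push_cast at hxt ⊢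
  have hx1 : |x + 1| < (t : ℝ) + 1 := by
    rw [abs_of_pos (by linarith)]
    linarith
  have e1 := ktPotential_succ_add_one ε hx1
  have e2 := ktPotential_succ_sub_one ε hx1
  rw [show x + 1 + 1 = x + 2 by ring] at e1
  rw [show x + 1 - 1 = x by ring] at e2
  have h0 := ktPotential_pos hε hx1
  rw [e1, e2, ← mul_assoc]
  refine mul_le_mul_of_nonneg_right ?_ h0.le
  have : 0 ≤ x / ((t : ℝ) + 1) := by positivity
  have h3 : x / ((t : ℝ) + 1) ≤ (x + 1) / (t + 1) := by gcongr; linarith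
  nlinarith

theorem ktPotential_add_two_mul_ge {ε : ℝ} (hε : 0 < ε) {t : ℕ} {x : ℝ} (hx : 0 ≤ x) (i : ℕ)
    (hxt : x + 2 * i ≤ t) :
    (1 + x / t) ^ i * ktPotential ε t x ≤ ktPotential ε t (x + 2 * i) := by
  induction i with
  | zero => simp
  | succ i ih =>
    push_cast at hxt ⊢
    have := ktPotential_add_two_ge hε (t := t) (x := x + 2 * i) (by positivity) (by linarith)
    rw [show x + 2 * ((i : ℝ) + 1) = x + 2 * i + 2 by ring]
    refine le_trans ?_ this
    rw [pow_succ', mul_assoc]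
    have hp := ktPotential_pos hε (t := t) (x := x)
      (by rw [abs_of_nonneg hx]; linarith [(Nat.cast_nonneg i : (0 : ℝ) ≤ i)])
    refine mul_le_mul ?_ (ih (by linarith)) (by positivity) (by positivity)
    gcongr
    simp

/-- Take `k = ⌊δt/4⌋`. The first `k` double steps from 0 lose nothing; the next `k` start beyond `2k
≥ δt/4`, so each gains a factor `1 + δ/4`, and they end at `4k ≤ y`. Exponential growth then beats
`K t (t + 1)`. -/
theorem ktPotential_superlinear {ε : ℝ} (hε : 0 < ε) {δ : ℝ} (hδ : 0 < δ) (K : ℝ) :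
    ∀ᶠ t : ℕ in Filter.atTop, ∀ y : ℝ, δ * t ≤ y → y ≤ t → K * t ≤ ktPotential ε t y := by
  obtain ⟨a, ha, hlow⟩ := ktPotential_at_zero_ge hε
  set b : ℝ := (1 + δ / 4) ^ (δ / 4) with hb
  have hb1 : 1 < b := Real.one_lt_rpow (by linarith) (by linarith)
  have hlim := tendsto_pow_const_div_const_pow_of_one_lt 2 hb1
  have hd : (0 : ℝ) < a / (2 * (1 + δ / 4) * (|K| + 1)) := by positivity
  filter_upwards [hlim.eventually_lt_const hd, Filter.eventually_ge_atTop ⌈8 / δ⌉₊,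
    Filter.eventually_ge_atTop 1] with t ht1 ht2 ht3 y hy1 hy2
  have ht2' : 8 / δ ≤ t := Nat.ceil_le.1 ht2
  have ht2'' : 8 ≤ δ * t := by rwa [div_le_iff₀' hδ] at ht2'
  have ht3' : (1 : ℝ) ≤ t := by exact_mod_cast ht3
  set k := ⌊δ * t / 4⌋₊ with hk
  have hk1 : (k : ℝ) ≤ δ * t / 4 := Nat.floor_le (by positivity)
  have hk2 : δ * t / 4 < k + 1 := Nat.lt_floor_add_one _
  have hk0 : (0 : ℝ) ≤ k := by positivity
  have f0 := hlow t
  have f1 := ktPotential_add_two_mul_ge hε (t := t) le_rfl k (by linarith)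
  have f2 := ktPotential_add_two_mul_ge hε (t := t) (x := 2 * k) (by positivity) k (by linarith)
  have f3 := ktPotential_mono hε (t := t) (x := 2 * k + 2 * k) (y := y) (by positivity)
    (by linarith) (by linarith)
  simp only [zero_div, add_zero, one_pow, one_mul, zero_add] at f1
  -- `δt ≥ 8` absorbs the floor: `k ≥ δt/4 - 1 ≥ δt/8`.
  have g1 : δ / 4 ≤ 2 * k / t := by
    rw [le_div_iff₀ (by linarith)]
    nlinarith
  have g2 : b ^ t ≤ (1 + δ / 4) * (1 + δ / 4) ^ k := by
    rw [hb, ← Real.rpow_natCast, ← Real.rpow_mul (by positivity), ← pow_succ',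
      ← Real.rpow_natCast _ (k + 1)]
    refine Real.rpow_le_rpow_of_exponent_le (by linarith) ?_
    push_cast
    linarith
  have g3 : (1 + δ / 4) ^ k * (a / (t + 1)) ≤ ktPotential ε t y := by
    refine le_trans ?_ (f2.trans f3)
    refine mul_le_mul (by gcongr) (f0.trans f1) (by positivity) (by positivity)
  refine le_trans ?_ g3
  rw [div_lt_div_iff₀ (by positivity) (by positivity)] at ht1
  have hKt : K * t ≤ (|K| + 1) * t := by gcongr; linarith [le_abs_self K]
  refine hKt.trans ?_
  rw [← mul_div_assoc, le_div_iff₀ (by positivity)]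
  have g4 : a * b ^ t ≤ a * ((1 + δ / 4) * (1 + δ / 4) ^ k) := by gcongr
  have hK1 : 0 < |K| + 1 := by positivity
  have g5 : (|K| + 1) * t * (t + 1) ≤ 2 * (|K| + 1) * t ^ 2 := by
    have : (t : ℝ) * (t + 1) ≤ 2 * t ^ 2 := by nlinarith
    nlinarith
  have g6 : (1 + δ / 4) * (2 * (|K| + 1) * t ^ 2) ≤ (1 + δ / 4) * ((1 + δ / 4) ^ k * a) := by
    linarith
  exact g5.trans (le_of_mul_le_mul_left g6 (by positivity))

/-! ### Geometric convergence of gossip. -/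

section PowerBound

attribute [local instance] Matrix.linftyOpNormedRing Matrix.linftyOpNormedAlgebra

theorem Matrix.spectralRadius_ne_top {N : ℕ} (A : Matrix (Fin N) (Fin N) ℂ) :
    spectralRadius ℂ A ≠ ⊤ := by
  rcases isEmpty_or_nonempty (Fin N) with h | h
  · rw [spectrum.SpectralRadius.of_subsingleton]
    exact ENNReal.zero_ne_top
  · exact ((spectrum.spectralRadius_le_nnnorm A).trans_lt ENNReal.coe_lt_top).ne

/-- Gelfand's formula gives the bound for all large `q`; the constant absorbs the finitely many
others. -/
theorem Matrix.exists_norm_pow_apply_le {N : ℕ} (A : Matrix (Fin N) (Fin N) ℂ) {r : ℝ}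
    (hr : (spectralRadius ℂ A).toReal < r) :
    ∃ C : ℝ, 0 ≤ C ∧ ∀ q i j, ‖(A ^ q) i j‖ ≤ C * r ^ q := by
  have hr0 : 0 < r := ENNReal.toReal_nonneg.trans_lt hr
  have hlt : spectralRadius ℂ A < ENNReal.ofReal r :=
    (ENNReal.lt_ofReal_iff_toReal_lt A.spectralRadius_ne_top).2 hr
  have hev := (spectrum.pow_norm_pow_one_div_tendsto_nhds_spectralRadius A).eventually_lt_const hlt
  have hO : (fun q : ℕ => A ^ q) =O[Filter.atTop] fun q : ℕ => r ^ q := by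
    refine Asymptotics.IsBigO.of_bound 1 ?_
    filter_upwards [hev, Filter.eventually_gt_atTop 0] with q hq hq0
    rw [ENNReal.ofReal_lt_ofReal_iff hr0] at hq
    rw [one_mul, Real.norm_of_nonneg (pow_nonneg hr0.le q)]
    have := pow_le_pow_left₀ (by positivity) hq.le q
    rwa [one_div, Real.rpow_inv_natCast_pow (norm_nonneg _) hq0.ne'] at this
  rw [← Nat.cofinite_eq_atTop] at hO
  obtain ⟨C, hC, hb⟩ := Asymptotics.bound_of_isBigO_cofinite hO
  refine ⟨C, hC.le, fun q i j => ?_⟩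
  have h1 := hb (x := q) (by positivity)
  rw [Real.norm_of_nonneg (pow_nonneg hr0.le q)] at h1
  refine le_trans ?_ h1
  rw [← coe_nnnorm, ← coe_nnnorm, NNReal.coe_le_coe, Matrix.linfty_opNNNorm_def]
  exact (Finset.single_le_sum (f := fun j => ‖(A ^ q) i j‖₊) (fun _ _ => zero_le) (Finset.mem_univ j)).trans
    (Finset.le_sup (f := fun i => ∑ j, ‖(A ^ q) i j‖₊) (Finset.mem_univ i))

end PowerBound

/-- The averaging matrix `J` satisfies `WJ = JW = J² = J`. The exponent must be positive, since the
zeroth power would drop `J`. -/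
theorem doublyStochastic_sub_average_pow_succ {N : ℕ} {W : Matrix (Fin N) (Fin N) ℝ} (hN : 0 < N)
    (hW : W ∈ doublyStochastic ℝ (Fin N)) (q : ℕ) :
    (W - Matrix.of fun _ _ => 1 / (N : ℝ)) ^ (q + 1) =
      W ^ (q + 1) - Matrix.of fun _ _ => 1 / (N : ℝ) := by
  set J : Matrix (Fin N) (Fin N) ℝ := Matrix.of fun _ _ => 1 / (N : ℝ) with hJ
  have hN' : (N : ℝ) ≠ 0 := by positivity
  have hJJ : J * J = J := by
    ext i j
    simp [hJ, Matrix.mul_apply, hN']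
  have hPJ : ∀ P ∈ doublyStochastic ℝ (Fin N), P * J = J := by
    intro P hP
    ext i j
    simp [hJ, Matrix.mul_apply, ← Finset.sum_mul, sum_row_of_mem_doublyStochastic hP]
  have hJW : J * W = J := by
    ext i j
    simp [hJ, Matrix.mul_apply, ← Finset.mul_sum, sum_col_of_mem_doublyStochastic hW]
  induction q with
  | zero => simp
  | succ q ih =>
    rw [pow_succ, ih, sub_mul, mul_sub, mul_sub, hPJ _ (pow_mem hW _), hJW, hJJ, ← pow_succ]
    simp

theorem exists_abs_gossip_pow_sub_le {N : ℕ} {W : Matrix (Fin N) (Fin N) ℝ} (hN : 0 < N)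
    (hW : W ∈ doublyStochastic ℝ (Fin N)) {r : ℝ} (hr : gossipRadius W < r) :
    ∃ C : ℝ, 0 ≤ C ∧ ∀ q, 0 < q → ∀ i j, |(W ^ q) i j - 1 / (N : ℝ)| ≤ C * r ^ q := by
  obtain ⟨C, hC, h⟩ := Matrix.exists_norm_pow_apply_le _ hr
  refine ⟨C, hC, fun q hq i j => ?_⟩
  obtain ⟨q, rfl⟩ := Nat.exists_eq_succ_of_ne_zero hq.ne'
  have h1 := h (q + 1) i j
  have h2 : ((W - Matrix.of fun _ _ => 1 / (N : ℝ)).map Complex.ofReal) ^ (q + 1) =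
      ((W - Matrix.of fun _ _ => 1 / (N : ℝ)) ^ (q + 1)).map Complex.ofReal :=
    (map_pow (Complex.ofRealHom.mapMatrix (m := Fin N)) _ _).symm
  rw [h2, doublyStochastic_sub_average_pow_succ hN hW, Matrix.map_apply, Complex.norm_real,
    Real.norm_eq_abs] at h1
  exact h1

theorem exists_abs_gossip_pow_ceil_sub_le {N : ℕ} {W : Matrix (Fin N) (Fin N) ℝ} (hN : 0 < N)
    (hW : W ∈ doublyStochastic ℝ (Fin N)) (hρ1 : gossipRadius W < 1) {c : ℝ} (hc : 0 < c)
    (hcρ : 0 < gossipRadius W → -2 * Real.log 2 / Real.log (gossipRadius W) ≤ c) :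
    ∃ C : ℝ, 0 ≤ C ∧ ∀ t : ℕ, 0 < t → ∀ i j,
      |(W ^ ⌈c * (t : ℝ)⌉₊) i j - 1 / (N : ℝ)| ≤ C * (1 / 3) ^ t := by
  -- Chosen so that `r^c = 1/3`. For positive radius `ρ` the hypothesis on `c` gives `ρ^c ≤ 1/4`,
  -- which leaves the strict gap `ρ < r` that Gelfand's formula needs; any rate below `1/2` would
  -- beat the factor `2^t`.
  set r := Real.exp (-Real.log 3 / c) with hr
  have hr1 : r ≤ 1 := by
    rw [hr, Real.exp_le_one_iff]
    have : 0 < Real.log 3 := Real.log_pos (by norm_num)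
    exact div_nonpos_of_nonpos_of_nonneg (by linarith) hc.le
  have hlt : gossipRadius W < r := by
    rcases (show 0 ≤ gossipRadius W from ENNReal.toReal_nonneg).eq_or_lt with h | h
    · rw [← h]
      exact Real.exp_pos _
    · have h1 := hcρ h
      have h2 : Real.log (gossipRadius W) < 0 := Real.log_neg h hρ1
      rw [div_le_iff_of_neg h2] at h1
      rw [hr, ← Real.log_lt_iff_lt_exp h, lt_div_iff₀ hc]
      have h3 : Real.log 3 < Real.log (2 ^ 2) := Real.log_lt_log (by norm_num) (by norm_num)
      rw [Real.log_pow] at h3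
      push_cast at h3
      linarith
  obtain ⟨C, hC, h⟩ := exists_abs_gossip_pow_sub_le hN hW hlt
  refine ⟨C, hC, fun t ht i j => (h _ (Nat.ceil_pos.2 (by positivity)) i j).trans ?_⟩
  gcongr
  have h0 : (1 / 3 : ℝ) ^ t = r ^ (c * t : ℝ) := by
    rw [hr, ← Real.exp_mul, show -Real.log 3 / c * (c * t) = Real.log (1 / 3) * t by
      rw [one_div, Real.log_inv]; field_simp, mul_comm, Real.exp_nat_mul,
      Real.exp_log (by norm_num)]
  rw [h0, ← Real.rpow_natCast]
  exact Real.rpow_le_rpow_of_exponent_ge (Real.exp_pos _) hr1 (Nat.le_ceil _)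

/-! ### Runs of DECO-ii compared with the virtual bettor. -/

theorem IsSubgradient.norm_le_one {H : Type*} [NormedAddCommGroup H] [InnerProductSpace ℝ H]
    {f : H → ℝ} (hf : LipschitzWith 1 f) {x g : H} (hg : IsSubgradient f x g) : ‖g‖ ≤ 1 := by
  have h1 := hg (x + g)
  have h2 := hf.dist_le_mul (x + g) x
  rw [Real.dist_eq, dist_eq_norm] at h2
  simp only [add_sub_cancel_left, NNReal.coe_one, one_mul, real_inner_self_eq_norm_sq] at h1 h2
  have h3 := (le_abs_self _).trans h2
  by_contra! h
  nlinarith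

/-- The average of finitely many vectors. -/
noncomputable def agentMean {N : ℕ} {H : Type*} [AddCommGroup H] [Module ℝ H] (f : Fin N → H) : H :=
  (1 / (N : ℝ)) • ∑ n, f n

theorem norm_agentMean_le {N : ℕ} {H : Type*} [NormedAddCommGroup H] [NormedSpace ℝ H]
    (hN : 0 < N) {f : Fin N → H} {b : ℝ} (hf : ∀ n, ‖f n‖ ≤ b) : ‖agentMean f‖ ≤ b := by
  have hN' : (0 : ℝ) < N := by exact_mod_cast hN
  rw [agentMean, norm_smul, Real.norm_of_nonneg (by positivity), one_div, inv_mul_le_iff₀ hN']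
  refine (norm_sum_le _ _).trans ((Finset.sum_le_card_nsmul _ _ b fun n _ => hf n).trans ?_)
  simp

theorem average_le {N : ℕ} (hN : 0 < N) {f : Fin N → ℝ} {b : ℝ} (hf : ∀ n, f n ≤ b) :
    (1 / (N : ℝ)) * ∑ n, f n ≤ b := by
  have hN' : (0 : ℝ) < N := by exact_mod_cast hN
  rw [one_div, inv_mul_le_iff₀ hN']
  refine (Finset.sum_le_card_nsmul _ _ b fun n _ => hf n).trans ?_
  simp

section Run

variable {N : ℕ} {H : Type*} [NormedAddCommGroup H] [InnerProductSpace ℝ H]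
  {F : ℕ → ℝ → ℝ} {W : Matrix (Fin N) (Fin N) ℝ} {q : ℕ → ℕ}
  {l : Fin N → ℕ → H → ℝ} {x g G : Fin N → ℕ → H}

theorem IsDecoRun.norm_subgradient_le (hl : AdmissibleLosses l) (h : IsDecoRun F W q l x g G)
    (n : Fin N) (t : ℕ) : ‖g n (t + 1)‖ ≤ 1 :=
  (h.feedback n (t + 1) (by simp)).norm_le_one (hl n (t + 1) (by simp)).2

/-- Unit row sums prevent gossip from enlarging the maximal norm. This keeps every bet inside the
domain of the potential. -/
theorem IsDecoRun.norm_state_le (hl : AdmissibleLosses l) (h : IsDecoRun F W q l x g G)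
    (hW : W ∈ doublyStochastic ℝ (Fin N)) (t : ℕ) (n : Fin N) : ‖G n t‖ ≤ t := by
  induction t generalizing n with
  | zero => simp [h.init]
  | succ t ih =>
    have hP := pow_mem hW (q (t + 1))
    rw [h.gossip n (t + 1) (by simp)]
    calc _ ≤ ∑ m, (W ^ q (t + 1)) n m * ((t + 1 : ℕ) : ℝ) := by
          refine norm_sum_le_of_le _ fun m _ => ?_
          rw [norm_smul, Real.norm_of_nonneg (nonneg_of_mem_doublyStochastic hP)]
          refine mul_le_mul_of_nonneg_left ?_ (nonneg_of_mem_doublyStochastic hP)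
          refine (norm_sub_le _ _).trans ?_
          push_cast
          exact add_le_add (ih m) (h.norm_subgradient_le hl m t)
      _ = _ := by rw [← Finset.sum_mul, sum_row_of_mem_doublyStochastic hP, one_mul]

/-- Unit column sums make gossip preserve the mean. -/
theorem IsDecoRun.agentMean_state_succ (h : IsDecoRun F W q l x g G)
    (hW : W ∈ doublyStochastic ℝ (Fin N)) (t : ℕ) :
    agentMean (fun n => G n (t + 1)) =
      agentMean (fun n => G n t) - agentMean (fun n => g n (t + 1)) := by
  unfold agentMean
  rw [← smul_sub, ← Finset.sum_sub_distrib]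
  congr 1
  have hP := pow_mem hW (q (t + 1))
  simp only [h.gossip _ (t + 1) (Nat.le_add_left 1 t), Nat.add_sub_cancel]
  rw [Finset.sum_comm]
  simp only [← Finset.sum_smul, sum_col_of_mem_doublyStochastic hP, one_smul]

theorem IsDecoRun.norm_state_sub_agentMean_le (hl : AdmissibleLosses l)
    (h : IsDecoRun F W q l x g G) (hW : W ∈ doublyStochastic ℝ (Fin N)) {C : ℝ}
    (hC : ∀ t : ℕ, 0 < t → ∀ i j, |(W ^ q t) i j - 1 / (N : ℝ)| ≤ C * (1 / 3) ^ t)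
    (t : ℕ) (n : Fin N) :
    ‖G n t - agentMean (fun m => G m t)‖ ≤ N * C * t * (1 / 3) ^ t := by
  cases t with
  | zero => simp [h.init, agentMean]
  | succ t =>
    have e : G n (t + 1) - agentMean (fun m => G m (t + 1)) =
        ∑ m, ((W ^ q (t + 1)) n m - 1 / (N : ℝ)) • (G m t - g m (t + 1)) := by
      rw [h.agentMean_state_succ hW, h.gossip n (t + 1) (Nat.le_add_left 1 t)]
      simp only [agentMean, sub_smul, Finset.sum_sub_distrib, smul_sub, Finset.smul_sum,
        Nat.add_sub_cancel]
      abel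
    rw [e]
    calc _ ≤ ∑ _m : Fin N, C * (1 / 3) ^ (t + 1) * ((t + 1 : ℕ) : ℝ) := by
          refine norm_sum_le_of_le _ fun m _ => ?_
          rw [norm_smul, Real.norm_eq_abs]
          have h1 := hC (t + 1) (by simp) n m
          refine mul_le_mul h1 ?_ (norm_nonneg _) ((abs_nonneg _).trans h1)
          refine (norm_sub_le _ _).trans ?_
          push_cast
          exact add_le_add (h.norm_state_le hl hW t m) (h.norm_subgradient_le hl m t)
      _ = _ := by
          simp only [Finset.sum_const, Finset.card_univ, Fintype.card_fin, nsmul_eq_mul]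
          ring

theorem IsDecoRun.norm_play_sub_le {ε : ℝ} (hε : 0 < ε) (hN : 0 < N) (hl : AdmissibleLosses l)
    (h : IsDecoRun (ktPotential ε) W q l x g G) (hW : W ∈ doublyStochastic ℝ (Fin N)) {C : ℝ}
    (hC : ∀ t : ℕ, 0 < t → ∀ i j, |(W ^ q t) i j - 1 / (N : ℝ)| ≤ C * (1 / 3) ^ t)
    (t : ℕ) (n : Fin N) :
    ‖x n (t + 1) - bettingMap (ktPotential ε) (t + 1) (agentMean fun m => G m t)‖ ≤
      8 * ktPotential ε 0 (1 / 2) * N * C * ((t + 1) * t * (2 / 3) ^ t) := by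
  rw [h.play n (t + 1) (by simp), Nat.add_sub_cancel]
  refine (norm_bettingMap_sub_le hε (h.norm_state_le hl hW t n)
    (norm_agentMean_le hN (h.norm_state_le hl hW t))).trans ?_
  have h0 := ktPotential_pos hε (t := 0) (x := 1 / 2) (by rw [abs_of_pos] <;> norm_num)
  refine (mul_le_mul_of_nonneg_left (h.norm_state_sub_agentMean_le hl hW hC t n)
    (by positivity)).trans (le_of_eq ?_)
  rw [show (2 / 3 : ℝ) = 2 * (1 / 3) by norm_num, mul_pow]
  ring

/-- At a common point `z` the excesses of global over local loss cancel on averaging, so only the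
distances of the plays to `z` count: once for the global and once for the local loss. -/
theorem abs_disagreement_le (hN : 0 < N) (hl : AdmissibleLosses l) {z : ℕ → H} {d : ℕ → ℝ}
    (hd : ∀ t n, ‖x n (t + 1) - z (t + 1)‖ ≤ d t) (T : ℕ) :
    |disagreement l x T| ≤ 2 * ∑ t ∈ Finset.range T, d t := by
  have hN' : (N : ℝ) ≠ 0 := by positivity
  unfold disagreement
  rw [show Finset.Icc 1 T = Finset.Ico (0 + 1) (T + 1) from rfl, ← Finset.sum_Ico_add',
    ← Finset.range_eq_Ico, Finset.mul_sum]
  refine Finset.abs_sum_le_sum_abs _ _ |>.trans (Finset.sum_le_sum fun t _ => ?_)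
  have lip : ∀ m n, |l m (t + 1) (x n (t + 1)) - l m (t + 1) (z (t + 1))| ≤ d t := by
    intro m n
    have := (hl m (t + 1) (by simp)).2.dist_le_mul (x n (t + 1)) (z (t + 1))
    rw [Real.dist_eq, dist_eq_norm, NNReal.coe_one, one_mul] at this
    exact this.trans (hd t n)
  have e0 : ∑ n, (globalLoss l (t + 1) (z (t + 1)) - l n (t + 1) (z (t + 1))) = 0 := by
    simp only [Finset.sum_sub_distrib, globalLoss, Finset.sum_const, Finset.card_univ,
      Fintype.card_fin, nsmul_eq_mul]
    field_simp
    ring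
  rw [← sub_zero (∑ n, (globalLoss l (t + 1) (x n (t + 1)) - _)), ← e0, ← Finset.sum_sub_distrib]
  refine norm_agentMean_le (H := ℝ) hN fun n => ?_
  have h1 : |globalLoss l (t + 1) (x n (t + 1)) - globalLoss l (t + 1) (z (t + 1))| ≤ d t := by
    unfold globalLoss
    rw [← mul_sub, ← Finset.sum_sub_distrib]
    exact norm_agentMean_le (H := ℝ) hN fun m => lip m n
  rw [Real.norm_eq_abs, sub_sub_sub_comm]
  refine (abs_sub _ _).trans ?_
  linarith [lip n n]

theorem IsDecoRun.ktPotential_add_sum_le {ε : ℝ} (hε : 0 < ε) (hN : 0 < N)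
    (hl : AdmissibleLosses l) (h : IsDecoRun (ktPotential ε) W q l x g G)
    (hW : W ∈ doublyStochastic ℝ (Fin N)) (T : ℕ) :
    ktPotential ε T ‖agentMean fun n => G n T‖ + ∑ t ∈ Finset.range T,
      inner ℝ (agentMean fun n => g n (t + 1))
        (bettingMap (ktPotential ε) (t + 1) (agentMean fun n => G n t)) ≤ ε := by
  induction T with
  | zero => simp [h.init, agentMean, ktPotential_zero_zero]
  | succ T ih =>
    have hG : ‖agentMean fun n => G n T‖ ≤ T := norm_agentMean_le hN (h.norm_state_le hl hW T)
    have h1 := ktPotential_norm_sub_le hε hG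
      (norm_agentMean_le hN fun n => h.norm_subgradient_le hl n T)
    rw [Finset.sum_range_succ, h.agentMean_state_succ hW, bettingMap_ktPotential hε (by linarith)]
    linarith

theorem IsDecoRun.agentMean_state_eq (h : IsDecoRun F W q l x g G)
    (hW : W ∈ doublyStochastic ℝ (Fin N)) (T : ℕ) :
    agentMean (fun n => G n T) = -∑ t ∈ Finset.range T, agentMean fun n => g n (t + 1) := by
  induction T with
  | zero => simp [h.init, agentMean]
  | succ T ih =>
    rw [h.agentMean_state_succ hW, ih, Finset.sum_range_succ]
    abel

/-- The disagreement trades global for local losses, which are linearised at each agent's own play;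
`d` then pays for moving to the virtual play, where the potential bound applies. -/
theorem IsDecoRun.networkRegret_le {ε : ℝ} (hε : 0 < ε) (hN : 0 < N)
    (hl : AdmissibleLosses l) (h : IsDecoRun (ktPotential ε) W q l x g G)
    (hW : W ∈ doublyStochastic ℝ (Fin N)) {d : ℕ → ℝ}
    (hd : ∀ t n, ‖x n (t + 1) - bettingMap (ktPotential ε) (t + 1) (agentMean fun m => G m t)‖
      ≤ d t) (u : H) (T : ℕ) :
    networkRegret l x u T ≤ disagreement l x T + ∑ t ∈ Finset.range T, d t + ε +
      (‖agentMean fun n => G n T‖ * ‖u‖ - ktPotential ε T ‖agentMean fun n => G n T‖) := by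
  have hN' : (N : ℝ) ≠ 0 := by positivity
  set z : ℕ → H := fun t => bettingMap (ktPotential ε) (t + 1) (agentMean fun m => G m t) with hz
  have e1 : networkRegret l x u T = disagreement l x T +
      ∑ t ∈ Finset.range T, (1 / (N : ℝ)) * ∑ n, (l n (t + 1) (x n (t + 1)) - l n (t + 1) u) := by
    rw [Finset.range_eq_Ico, Finset.sum_Ico_add' (fun t => (1 / (N : ℝ)) *
      ∑ n, (l n t (x n t) - l n t u)) 0 T 1]
    unfold networkRegret disagreement
    rw [← Finset.sum_sub_distrib]
    refine Eq.trans ?_ Finset.sum_add_distrib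
    refine Finset.sum_congr rfl fun t _ => ?_
    simp only [Finset.sum_sub_distrib, globalLoss]
    ring
  have e2 : ∀ t ∈ Finset.range T,
      (1 / (N : ℝ)) * ∑ n, (l n (t + 1) (x n (t + 1)) - l n (t + 1) u) ≤
        d t + (inner ℝ (agentMean fun n => g n (t + 1)) (z t) -
          inner ℝ (agentMean fun n => g n (t + 1)) u) := by
    intro t _
    have e3 : inner ℝ (agentMean fun n => g n (t + 1)) (z t) -
          inner ℝ (agentMean fun n => g n (t + 1)) u =
        (1 / (N : ℝ)) * ∑ n, inner ℝ (g n (t + 1)) (z t - u) := by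
      rw [← inner_sub_right, agentMean, real_inner_smul_left, sum_inner]
    rw [e3, ← sub_le_iff_le_add, ← mul_sub, ← Finset.sum_sub_distrib]
    refine average_le hN fun n => ?_
    have h1 := h.feedback n (t + 1) (by simp) u
    have h2 : inner ℝ (g n (t + 1)) (x n (t + 1) - z t) ≤ d t := by
      refine (real_inner_le_norm _ _).trans ((mul_le_of_le_one_left (norm_nonneg _)
        (h.norm_subgradient_le hl n t)).trans (hd t n))
    simp only [inner_sub_right] at h1 h2 ⊢
    linarith
  have e4 := Finset.sum_le_sum e2
  rw [Finset.sum_add_distrib, Finset.sum_sub_distrib, ← sum_inner] at e4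
  have e5 := h.ktPotential_add_sum_le hε hN hl hW T
  have e6 : -inner ℝ (∑ t ∈ Finset.range T, agentMean fun n => g n (t + 1)) u ≤
      ‖agentMean fun n => G n T‖ * ‖u‖ := by
    rw [← inner_neg_left, ← h.agentMean_state_eq hW]
    exact real_inner_le_norm _ _
  rw [e1]
  linarith

end Run

/-! ### Sublinear bounds and conclusion. -/

/-- The largest positive value of `y * U - F_t y` over `0 ≤ y ≤ t`. -/
noncomputable def ktConjugate (ε U : ℝ) (t : ℕ) : ℝ :=
  sSup ((fun y => max 0 (y * U - ktPotential ε t y)) '' Set.Icc 0 (t : ℝ))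

theorem le_ktConjugate {ε : ℝ} (hε : 0 < ε) {U : ℝ} (hU : 0 ≤ U) {t : ℕ} {y : ℝ} (hy0 : 0 ≤ y)
    (hy : y ≤ t) : y * U - ktPotential ε t y ≤ ktConjugate ε U t := by
  refine (le_max_right 0 _).trans (le_csSup ⟨t * U, ?_⟩ ⟨y, ⟨hy0, hy⟩, rfl⟩)
  rintro _ ⟨s, ⟨hs0, hs⟩, rfl⟩
  have h0 := ktPotential_pos hε (t := t) (x := s) (by rw [abs_of_nonneg hs0]; linarith)
  have h1 : s * U ≤ t * U := by gcongr
  exact max_le (by positivity) (by linarith)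

/-- Split at `y = δt/(U + 1)`: below it `yU ≤ δt`, above it the potential eventually exceeds `Ut ≥
yU`. -/
theorem isSublinear_ktConjugate {ε : ℝ} (hε : 0 < ε) {U : ℝ} (hU : 0 ≤ U) :
    IsSublinear (ktConjugate ε U) := by
  refine Asymptotics.isLittleO_iff.2 fun δ hδ => ?_
  filter_upwards [ktPotential_superlinear hε (δ := δ / (U + 1)) (by positivity) U] with t ht
  have h0 : 0 ≤ ktConjugate ε U t := by
    refine Real.sSup_nonneg ?_
    rintro _ ⟨s, -, rfl⟩
    exact le_max_left _ _
  rw [Real.norm_of_nonneg h0, Real.norm_of_nonneg (Nat.cast_nonneg t)]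
  refine Real.sSup_le ?_ (by positivity)
  rintro _ ⟨y, ⟨hy0, hy⟩, rfl⟩
  have hp := ktPotential_pos hε (t := t) (x := y) (by rw [abs_of_nonneg hy0]; linarith)
  have hδt : 0 ≤ δ * (t : ℝ) := by positivity
  refine max_le hδt ?_
  rcases le_total (δ / (U + 1) * t) y with h | h
  · have := ht y h hy
    have : y * U ≤ U * t := by nlinarith
    linarith
  · have h1 : y * U ≤ δ / (U + 1) * t * (U + 1) := by gcongr; linarith
    have h2 : δ / (U + 1) * t * (U + 1) = δ * t := by field_simp
    linarith

theorem isSublinear_const (b : ℝ) : IsSublinear fun _ => b :=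
  Asymptotics.isLittleO_const_left.2 (Or.inr
    (tendsto_norm_atTop_atTop.comp tendsto_natCast_atTop_atTop))

theorem summable_gossip_error :
    Summable fun t : ℕ => ((t : ℝ) + 1) * t * (2 / 3) ^ t := by
  have h1 := summable_pow_mul_geometric_of_norm_lt_one (R := ℝ) 2 (r := 2 / 3) (by norm_num)
  have h2 := summable_pow_mul_geometric_of_norm_lt_one (R := ℝ) 1 (r := 2 / 3) (by norm_num)
  refine (h1.add h2).congr fun t => ?_
  ring

theorem mainTheorem6 {N : ℕ} {H : Type*} [NormedAddCommGroup H] [InnerProductSpace ℝ H]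
    [CompleteSpace H] (𝒢 : SimpleGraph (Fin N)) (W : Matrix (Fin N) (Fin N) ℝ)
    (hW : IsGossipMatrix 𝒢 W) (ε : ℝ) (hε : 0 < ε) (c : ℝ) (hc : 0 < c)
    (hcρ : 0 < gossipRadius W → -2 * Real.log 2 / Real.log (gossipRadius W) ≤ c) :
    (∀ t : ℕ, 1 ≤ t → ∀ y : ℝ, |y| < t → bettingFraction (ktPotential ε) t y = y / t) ∧
    (∀ u : H, ∃ B : ℕ → ℝ, IsSublinear B ∧
      ∀ (l : Fin N → ℕ → H → ℝ) (x g G : Fin N → ℕ → H), AdmissibleLosses l →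
        IsDecoRun (ktPotential ε) W (fun t => ⌈c * (t : ℝ)⌉₊) l x g G →
        ∀ T : ℕ, networkRegret l x u T ≤ B T) ∧
    (∃ B : ℕ → ℝ, IsSublinear B ∧
      ∀ (l : Fin N → ℕ → H → ℝ) (x g G : Fin N → ℕ → H), AdmissibleLosses l →
        IsDecoRun (ktPotential ε) W (fun t => ⌈c * (t : ℝ)⌉₊) l x g G →
        ∀ T : ℕ, |disagreement l x T| ≤ B T) := by

  have hN : 0 < N := by
    obtain ⟨i⟩ := hW.connected.nonempty
    exact i.pos
  have hS := hW.doublyStochastic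
  obtain ⟨C, hC0, hC⟩ := exists_abs_gossip_pow_ceil_sub_le hN hS hW.radius_lt_one hc hcρ
  set d : ℕ → ℝ := fun t =>
    8 * ktPotential ε 0 (1 / 2) * N * C * (((t : ℝ) + 1) * t * (2 / 3) ^ t) with hd
  have hd0 : ∀ t, 0 ≤ d t := by
    intro t
    have h0 := ktPotential_pos hε (t := 0) (x := 1 / 2) (by rw [abs_of_pos] <;> norm_num)
    positivity
  have hsum : ∀ T, ∑ t ∈ Finset.range T, d t ≤ ∑' t, d t := fun T =>
    (summable_gossip_error.mul_left _).sum_le_tsum _ fun t _ => hd0 t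
  have hdis : ∀ (l : Fin N → ℕ → H → ℝ) (x g G : Fin N → ℕ → H), AdmissibleLosses l →
      IsDecoRun (ktPotential ε) W (fun t => ⌈c * (t : ℝ)⌉₊) l x g G →
      ∀ T : ℕ, |disagreement l x T| ≤ 2 * ∑' t, d t := by
    intro l x g G hl hrun T
    refine (abs_disagreement_le hN hl (z := fun t => bettingMap (ktPotential ε) t
      (agentMean fun m => G m (t - 1))) (fun t n => hrun.norm_play_sub_le hε hN hl hS hC t n)
      T).trans ?_
    have := hsum T
    gcongr
  -- Of the three error sums, two come from the disagreement and one from replacing local plays by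
  -- the virtual one.
  refine ⟨fun t ht y hy => ?_, fun u => ⟨fun T => (3 * ∑' t, d t + ε) + ktConjugate ε ‖u‖ T,
    (isSublinear_const _).add (isSublinear_ktConjugate hε (norm_nonneg u)), ?_⟩,
    ⟨fun _ => 2 * ∑' t, d t, isSublinear_const _, hdis⟩⟩
  · obtain ⟨t, rfl⟩ := Nat.exists_eq_succ_of_ne_zero (Nat.one_le_iff_ne_zero.1 ht)
    push_cast at hy ⊢
    exact bettingFraction_ktPotential hε hy
  · intro l x g G hl hrun T
    have h1 := hrun.networkRegret_le hε hN hl hS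
      (fun t n => hrun.norm_play_sub_le hε hN hl hS hC t n) u T
    have h2 := (le_abs_self _).trans (hdis l x g G hl hrun T)
    have h3 := hsum T
    have h4 := le_ktConjugate hε (norm_nonneg u) (norm_nonneg (agentMean fun n => G n T))
      (norm_agentMean_le hN (hrun.norm_state_le hl hS T))
    linarith
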